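/- Let $n_1,\dots,n_k$ ($k\ge 0$) be positive integers, exactly $s$ of which are even, and let $G=\mathbb{Z}_{n_1}\times\cdots\times\mathbb{Z}_{n_k}$, written multiplicatively with identity $e$. A $G$-graded twisted $\mathbb{R}$-algebra is a (not necessarily associative) $\mathbb{R}$-algebra $W$ with identity element $1$, together with a decomposition $W=\bigoplus_{g\in G}W_g$ into one-dimensional subspaces, such that $W_aW_b\subseteq W_{ab}$ for all $a,b\in G$, such that $1\in W_e$, and such that $w_aw_b\ne 0$ for all nonzero $w_a\in W_a$, $w_b\in W_b$. A graded isomorphism $W\to V$ of such algebras is a bijective unital homomorphism of $\mathbb{R}$-algebras $\varphi$ with $\varphi(W_g)\subseteq V_g$ for all $g\in G$ (its inverse then also respects the gradings). Theorem. There are exactly $2^{s(s+1)/2}$ graded-isomorphism classes of associative $G$-graded twisted $\mathbb{R}$-algebras. -/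

import Mathlib

universe u v w

/-- A `G`-graded twisted algebra over a field `K`: a unital, not necessarily associative
`K`-algebra `W = ⨁ g, W_g` with `W_a W_b ⊆ W_{ab}`, every `W_g` one-dimensional,
no monomial zero divisors, and `1 ∈ W_e`. -/
structure GradedTwistedAlgebra (K : Type u) (G : Type v) [Field K] [Group G] [DecidableEq G] where
  carrier : Type w
  [ring : NonAssocRing carrier]
  [module : Module K carrier]
  [isScalarTower : IsScalarTower K carrier carrier]
  [smulCommClass : SMulCommClass K carrier carrier]
  component : G → Submodule K carrier
  isInternal : DirectSum.IsInternal component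
  mul_mem : ∀ (a b : G) (x y : carrier),
    x ∈ component a → y ∈ component b → x * y ∈ component (a * b)
  finrank_eq_one : ∀ g : G, Module.finrank K (component g) = 1
  mul_ne_zero : ∀ (a b : G) (x y : carrier),
    x ∈ component a → y ∈ component b → x ≠ 0 → y ≠ 0 → x * y ≠ 0
  one_mem : (1 : carrier) ∈ component 1

namespace GradedTwistedAlgebra

variable {K : Type u} {G : Type v} [Field K] [Group G] [DecidableEq G]

attribute [instance] ring module isScalarTower smulCommClass

/-- Associativity of the multiplication. -/
def IsAssociative (W : GradedTwistedAlgebra.{u, v, w} K G) : Prop :=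
  ∀ x y z : W.carrier, (x * y) * z = x * (y * z)

/-- A graded morphism: a unital homomorphism of `K`-algebras mapping `W_g` into `V_g`
for every `g`. -/
structure GradedHom (W V : GradedTwistedAlgebra.{u, v, w} K G) where
  toLinearMap : W.carrier →ₗ[K] V.carrier
  map_one : toLinearMap 1 = 1
  map_mul : ∀ x y : W.carrier, toLinearMap (x * y) = toLinearMap x * toLinearMap y
  map_mem : ∀ (g : G) (x : W.carrier), x ∈ W.component g → toLinearMap x ∈ V.component g

/-- Graded isomorphy: there are mutually inverse graded morphisms. -/
def GradedIsomorphic (W V : GradedTwistedAlgebra.{u, v, w} K G) : Prop :=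
  ∃ (φ : GradedHom W V) (ψ : GradedHom V W),
    (∀ x, ψ.toLinearMap (φ.toLinearMap x) = x) ∧ (∀ y, φ.toLinearMap (ψ.toLinearMap y) = y)

theorem GradedIsomorphic.refl (W : GradedTwistedAlgebra.{u, v, w} K G) : GradedIsomorphic W W :=
  ⟨⟨LinearMap.id, rfl, fun _ _ => rfl, fun _ _ h => h⟩,
    ⟨LinearMap.id, rfl, fun _ _ => rfl, fun _ _ h => h⟩, fun _ => rfl, fun _ => rfl⟩

theorem GradedIsomorphic.symm {W V : GradedTwistedAlgebra.{u, v, w} K G}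
    (h : GradedIsomorphic W V) : GradedIsomorphic V W :=
  let ⟨φ, ψ, h₁, h₂⟩ := h
  ⟨ψ, φ, h₂, h₁⟩

/-- Composition of graded morphisms. -/
def GradedHom.comp {U V W : GradedTwistedAlgebra.{u, v, w} K G}
    (ψ : GradedHom V W) (φ : GradedHom U V) : GradedHom U W where
  toLinearMap := ψ.toLinearMap ∘ₗ φ.toLinearMap
  map_one := by simp [φ.map_one, ψ.map_one]
  map_mul x y := by simp [φ.map_mul, ψ.map_mul]
  map_mem g x hx := ψ.map_mem g _ (φ.map_mem g x hx)

theorem GradedIsomorphic.trans {U V W : GradedTwistedAlgebra.{u, v, w} K G}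
    (h : GradedIsomorphic U V) (h' : GradedIsomorphic V W) : GradedIsomorphic U W := by
  obtain ⟨φ, ψ, h₁, h₂⟩ := h
  obtain ⟨φ', ψ', h₁', h₂'⟩ := h'
  refine ⟨φ'.comp φ, ψ.comp ψ', fun x => ?_, fun y => ?_⟩
  · simp [GradedHom.comp, h₁, h₁']
  · simp [GradedHom.comp, h₂, h₂']

/-- Graded isomorphy as an equivalence relation on associative `G`-graded twisted
`K`-algebras. -/
def assocSetoid (K : Type u) (G : Type v) [Field K] [Group G] [DecidableEq G] :
    Setoid {W : GradedTwistedAlgebra.{u, v, w} K G // W.IsAssociative} where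
  r W V := GradedIsomorphic W.1 V.1
  iseqv := ⟨fun W => GradedIsomorphic.refl W.1, GradedIsomorphic.symm, GradedIsomorphic.trans⟩

/-- The collection of graded-isomorphism classes of associative `G`-graded twisted
`K`-algebras. -/
def AssocIsoClasses (K : Type u) (G : Type v) [Field K] [Group G] [DecidableEq G] :
    Type (max u v (w + 1)) :=
  Quotient (assocSetoid.{u, v, w} K G)

end GradedTwistedAlgebra

/-! A nonzero element in each degree (1 in degree `1`) turns an associative algebra into a
normalized 2-cocycle `α : G → G → ℝˣ`. Graded isomorphism becomes equality of cocycles up to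
coboundary, and every normalized cocycle occurs, so the classes to count are those of `H²(G, ℝˣ)`.

For abelian `G` the quotient `α x y / α y x` is an alternating bicharacter. Its value on the
generators `i`, `j` is killed by both `n i` and `n j`, so it is `±1`, with `-1` possible only if
both are even. Dividing `α` by an upper-triangular bicharacter with the same commutator leaves a
symmetric cocycle, that is, an abelian extension. This is governed by the `n i`-th powers of lifted
generators, taken in `ℝˣ` modulo `n i`-th powers: a sign for even `n i`, nothing for odd
(`exists_carry_form`, `exists_pow_mul_eq_unit`).

So a class is given by one sign for each unordered pair, possibly diagonal, of even indices.
`IsNormalizedCocycle.exists_signMatrix` shows that the resulting standard cocycles exhaust the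
classes, and `eq_of_stdCocycle_cohomologous` that they are pairwise inequivalent. -/

namespace GradedTwistedAlgebra

/-! ### Graded algebras and cocycles -/

section Frames

variable {K : Type u} {G : Type v} [Field K] [Group G] [DecidableEq G]

/-- A normalized 2-cocycle on `G` with values in `Kˣ` (trivial action). -/
structure IsNormalizedCocycle (α : G → G → Kˣ) : Prop where
  assoc : ∀ a b c, α a b * α (a * b) c = α b c * α a (b * c)
  one_left : ∀ a, α 1 a = 1
  one_right : ∀ a, α a 1 = 1

/-- A choice of nonzero homogeneous elements, one in each degree, multiplying according to `α`. -/
structure IsFrame (W : GradedTwistedAlgebra.{u, v, w} K G) (α : G → G → Kˣ)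
    (u : G → W.carrier) : Prop where
  mem : ∀ g, u g ∈ W.component g
  ne_zero : ∀ g, u g ≠ 0
  one : u 1 = 1
  mul : ∀ a b, u a * u b = (α a b : K) • u (a * b)

variable {W V : GradedTwistedAlgebra.{u, v, w} K G}

theorem exists_smul_eq {g : G} {x y : W.carrier} (hx : x ∈ W.component g) (hx0 : x ≠ 0)
    (hy : y ∈ W.component g) : ∃ c : K, c • x = y := by
  obtain ⟨c, hc⟩ := exists_smul_eq_of_finrank_eq_one (W.finrank_eq_one g)
    (x := ⟨x, hx⟩) (by simpa [Subtype.ext_iff] using hx0) ⟨y, hy⟩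
  exact ⟨c, congrArg Subtype.val hc⟩

theorem exists_units_smul_eq {g : G} {x y : W.carrier} (hx : x ∈ W.component g) (hx0 : x ≠ 0)
    (hy : y ∈ W.component g) (hy0 : y ≠ 0) : ∃ c : Kˣ, (c : K) • x = y := by
  obtain ⟨c, hc⟩ := exists_smul_eq hx hx0 hy
  refine ⟨Units.mk0 c ?_, hc⟩
  rintro rfl
  exact hy0 (by rw [← hc, zero_smul])

theorem exists_mem_ne_zero (W : GradedTwistedAlgebra.{u, v, w} K G) (g : G) :
    ∃ x ∈ W.component g, x ≠ 0 := by
  refine (W.component g).exists_mem_ne_zero_of_ne_bot fun h => ?_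
  have := W.finrank_eq_one g
  rw [h, finrank_bot] at this
  exact zero_ne_one this

theorem one_ne_zero (W : GradedTwistedAlgebra.{u, v, w} K G) : (1 : W.carrier) ≠ 0 := by
  obtain ⟨x, -, hx⟩ := W.exists_mem_ne_zero 1
  intro h
  exact hx (by rw [← mul_one x, h, mul_zero])

theorem exists_isFrame (W : GradedTwistedAlgebra.{u, v, w} K G) :
    ∃ α u, IsFrame W α u := by
  have h : ∀ g, ∃ x ∈ W.component g, x ≠ 0 ∧ (g = 1 → x = 1) := fun g => by
    rcases eq_or_ne g 1 with rfl | hg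
    · exact ⟨1, W.one_mem, W.one_ne_zero, fun _ => rfl⟩
    · obtain ⟨x, hx, hx0⟩ := W.exists_mem_ne_zero g
      exact ⟨x, hx, hx0, fun h => absurd h hg⟩
  choose u mem ne one using h
  have h' : ∀ a b, ∃ c : Kˣ, (c : K) • u (a * b) = u a * u b := fun a b =>
    exists_units_smul_eq (mem _) (ne _) (W.mul_mem a b _ _ (mem a) (mem b))
      (W.mul_ne_zero a b _ _ (mem a) (mem b) (ne a) (ne b))
  choose α hα using h'
  exact ⟨α, u, mem, ne, one 1 rfl, fun a b => (hα a b).symm⟩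

namespace IsFrame

variable {α : G → G → Kˣ} {u : G → W.carrier}

theorem isNormalizedCocycle (h : IsFrame W α u) (hW : W.IsAssociative) :
    IsNormalizedCocycle α where
  assoc a b c := by
    have := hW (u a) (u b) (u c)
    rw [h.mul, h.mul, smul_mul_assoc, mul_smul_comm, h.mul, h.mul, smul_smul, smul_smul,
      mul_assoc] at this
    exact Units.ext (by simpa using smul_left_injective K (h.ne_zero _) this)
  one_left a := by
    have := h.mul 1 a
    rw [h.one, one_mul, one_mul] at this
    nth_rw 1 [← one_smul K (u a)] at this
    exact Units.ext (by simpa using (smul_left_injective K (h.ne_zero a) this).symm)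
  one_right a := by
    have := h.mul a 1
    rw [h.one, mul_one, mul_one] at this
    nth_rw 1 [← one_smul K (u a)] at this
    exact Units.ext (by simpa using (smul_left_injective K (h.ne_zero a) this).symm)

theorem linearIndependent (h : IsFrame W α u) : LinearIndependent K u :=
  W.isInternal.submodule_iSupIndep.linearIndependent _ h.mem h.ne_zero

theorem span_eq_top (h : IsFrame W α u) : Submodule.span K (Set.range u) = ⊤ := by
  rw [eq_top_iff, ← W.isInternal.submodule_iSup_eq_top, iSup_le_iff]
  intro g x hx
  obtain ⟨c, rfl⟩ := exists_smul_eq (h.mem g) (h.ne_zero g) hx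
  exact Submodule.smul_mem _ _ (Submodule.subset_span ⟨g, rfl⟩)

/-- A frame as a basis. -/
noncomputable def basis (h : IsFrame W α u) : Module.Basis G K W.carrier :=
  .mk h.linearIndependent h.span_eq_top.ge

@[simp] theorem basis_apply (h : IsFrame W α u) (g : G) : h.basis g = u g := by
  simp [basis]

theorem isAssociative (h : IsFrame W α u) (hα : IsNormalizedCocycle α) : W.IsAssociative := by
  have key : ∀ a b c, (u a * u b) * u c = u a * (u b * u c) := fun a b c => by
    rw [h.mul, h.mul, smul_mul_assoc, mul_smul_comm, h.mul, h.mul, smul_smul, smul_smul,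
      mul_assoc]
    congr 1
    exact_mod_cast congrArg Units.val (hα.assoc a b c)
  let L : W.carrier →ₗ[K] W.carrier →ₗ[K] W.carrier := LinearMap.mul K W.carrier
  intro x y z
  have hx : x ∈ Submodule.span K (Set.range u) := h.span_eq_top ▸ Submodule.mem_top
  have hy : y ∈ Submodule.span K (Set.range u) := h.span_eq_top ▸ Submodule.mem_top
  have hz : z ∈ Submodule.span K (Set.range u) := h.span_eq_top ▸ Submodule.mem_top
  induction hx using Submodule.span_induction with
  | zero => simp
  | add x x' _ _ h1 h2 => simp only [add_mul, h1, h2]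
  | smul c x _ h1 => simp only [smul_mul_assoc, h1]
  | mem x hx =>
    obtain ⟨a, rfl⟩ := hx
    induction hy using Submodule.span_induction with
    | zero => simp
    | add x x' _ _ h1 h2 => simp only [add_mul, mul_add, h1, h2]
    | smul c x _ h1 => simp only [smul_mul_assoc, mul_smul_comm, h1]
    | mem y hy =>
      obtain ⟨b, rfl⟩ := hy
      induction hz using Submodule.span_induction with
      | zero => simp
      | add x x' _ _ h1 h2 => simp only [mul_add, h1, h2]
      | smul c x _ h1 => simp only [mul_smul_comm, h1]
      | mem z hz =>
        obtain ⟨c, rfl⟩ := hz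
        exact key a b c

/-- Rescaling a frame changes the cocycle by a coboundary. -/
theorem rescale (h : IsFrame W α u) {α' : G → G → Kˣ} {t : G → Kˣ} (ht : t 1 = 1)
    (hα : ∀ a b, t a * t b * α a b = α' a b * t (a * b)) :
    IsFrame W α' fun g => (t g : K) • u g where
  mem g := Submodule.smul_mem _ _ (h.mem g)
  ne_zero g := smul_ne_zero (t g).ne_zero (h.ne_zero g)
  one := by simp [ht, h.one]
  mul a b := by
    rw [smul_mul_assoc, mul_smul_comm, h.mul, smul_smul, smul_smul, smul_smul]
    congr 1
    exact_mod_cast congrArg Units.val (hα a b)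

/-- The graded morphism between two algebras with frames for the same cocycle. -/
noncomputable def hom {v : G → V.carrier} (h : IsFrame W α u) (h' : IsFrame V α v) :
    GradedHom W V where
  toLinearMap := h.basis.constr K v
  map_one := by rw [← h.one, ← h.basis_apply, Module.Basis.constr_basis, h'.one]
  map_mul := by
    set f := h.basis.constr K v with hf
    -- Multiplicativity is an equality of bilinear maps, so basis elements suffice.
    have key : (LinearMap.mul K W.carrier).compr₂ f = (LinearMap.mul K V.carrier).compl₁₂ f f := by
      refine LinearMap.ext_basis h.basis h.basis fun a b => ?_
      have hfu : ∀ g, f (u g) = v g := fun g => by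
        rw [← h.basis_apply, hf, Module.Basis.constr_basis]
      simp [h.mul, h'.mul, hfu]
    exact fun x y => LinearMap.congr_fun₂ key x y
  map_mem g x hx := by
    obtain ⟨c, rfl⟩ := exists_smul_eq (h.mem g) (h.ne_zero g) hx
    rw [map_smul, ← h.basis_apply, Module.Basis.constr_basis]
    exact Submodule.smul_mem _ _ (h'.mem g)

theorem hom_apply {v : G → V.carrier} (h : IsFrame W α u) (h' : IsFrame V α v) (g : G) :
    (h.hom h').toLinearMap (u g) = v g := by
  rw [hom, ← h.basis_apply, Module.Basis.constr_basis]

theorem hom_hom {v : G → V.carrier} (h : IsFrame W α u) (h' : IsFrame V α v) (x : W.carrier) :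
    (h'.hom h).toLinearMap ((h.hom h').toLinearMap x) = x := by
  refine LinearMap.congr_fun (f := (h'.hom h).toLinearMap ∘ₗ (h.hom h').toLinearMap)
    (g := LinearMap.id) (h.basis.ext fun g => ?_) x
  simp [hom_apply]

theorem gradedIsomorphic {v : G → V.carrier} (h : IsFrame W α u) (h' : IsFrame V α v) :
    GradedIsomorphic W V :=
  ⟨h.hom h', h'.hom h, h.hom_hom h', h'.hom_hom h⟩

/-- An injective graded morphism sends each line `W_g` onto `V_g`, hence `u g` to a unit multiple of
`v g`; these units form the coboundary. -/
theorem exists_cohomologous {α' : G → G → Kˣ} {v : G → V.carrier} (h : IsFrame W α u)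
    (h' : IsFrame V α' v) (hWV : GradedIsomorphic W V) :
    ∃ t : G → Kˣ, ∀ a b, α a b * t (a * b) = t a * t b * α' a b := by
  obtain ⟨φ, ψ, hφ, -⟩ := hWV
  have h1 : ∀ g, ∃ c : Kˣ, (c : K) • v g = φ.toLinearMap (u g) := fun g => by
    refine exists_units_smul_eq (h'.mem g) (h'.ne_zero g) (φ.map_mem g _ (h.mem g)) fun h0 => ?_
    exact h.ne_zero g (by rw [← hφ (u g), h0, map_zero])
  choose t ht using h1
  refine ⟨t, fun a b => Units.ext ?_⟩
  have := φ.map_mul (u a) (u b)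
  rw [h.mul, map_smul, ← ht, ← ht, ← ht, smul_mul_assoc, mul_smul_comm, h'.mul, smul_smul,
    smul_smul, smul_smul] at this
  simpa [mul_assoc] using smul_left_injective K (h'.ne_zero _) this

end IsFrame

end Frames

/-! ### Every normalized cocycle comes from an algebra -/

section TwistedGroupAlgebra

variable {K : Type} {G : Type} [Field K] [Group G]

/-- The vector space underlying the twisted group algebra of `α`. -/
def Twisted (_ : G → G → Kˣ) : Type w := ULift.{w} G →₀ K

namespace Twisted

variable (α : G → G → Kˣ)

noncomputable instance : AddCommGroup (Twisted.{w} α) :=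
  inferInstanceAs (AddCommGroup (ULift.{w} G →₀ K))

noncomputable instance : Module K (Twisted.{w} α) :=
  inferInstanceAs (Module K (ULift.{w} G →₀ K))

/-- The standard basis of the twisted group algebra. -/
noncomputable def basis : Module.Basis G K (Twisted.{w} α) :=
  (Module.Basis.ofRepr (LinearEquiv.refl K (ULift.{w} G →₀ K))).reindex Equiv.ulift

/-- The multiplication of the twisted group algebra, as a bilinear map. -/
noncomputable def mulHom : Twisted.{w} α →ₗ[K] Twisted.{w} α →ₗ[K] Twisted.{w} α :=
  (basis α).constr K fun a => (basis α).constr K fun b => (α a b : K) • basis α (a * b)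

theorem mulHom_basis (a b : G) :
    mulHom.{w} α (basis α a) (basis α b) = (α a b : K) • basis α (a * b) := by
  simp [mulHom]

variable {α}

theorem mulHom_one_left (hα : IsNormalizedCocycle α) (x : Twisted.{w} α) :
    mulHom α (basis α 1) x = x := by
  refine LinearMap.congr_fun (g := LinearMap.id) ((basis α).ext fun g => ?_) x
  simp [mulHom_basis, hα.one_left]

theorem mulHom_one_right (hα : IsNormalizedCocycle α) (x : Twisted.{w} α) :
    mulHom α x (basis α 1) = x := by
  refine LinearMap.congr_fun (f := (mulHom α).flip (basis α 1)) (g := LinearMap.id)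
    ((basis α).ext fun g => ?_) x
  simp [mulHom_basis, hα.one_right]

/-- The ring structure of the twisted group algebra. -/
noncomputable abbrev nonAssocRing (hα : IsNormalizedCocycle α) :
    NonAssocRing (Twisted.{w} α) where
  mul x y := mulHom α x y
  one := basis α 1
  left_distrib x y z := map_add (mulHom α x) y z
  right_distrib x y z := LinearMap.map_add₂ (mulHom α) x y z
  zero_mul x := LinearMap.map_zero₂ (mulHom α) x
  mul_zero x := map_zero (mulHom α x)
  one_mul := mulHom_one_left hα
  mul_one := mulHom_one_right hα

end Twisted

variable [DecidableEq G]

/-- The twisted group algebra of a normalized cocycle. -/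
noncomputable def twisted {α : G → G → Kˣ} (hα : IsNormalizedCocycle α) :
    GradedTwistedAlgebra.{0, 0, w} K G :=
  letI := Twisted.nonAssocRing.{w} hα
  { carrier := Twisted.{w} α
    isScalarTower := ⟨fun c x y => LinearMap.map_smul₂ (Twisted.mulHom α) c x y⟩
    smulCommClass := ⟨fun c x y => (map_smul (Twisted.mulHom α x) c y).symm⟩
    component := fun g => Submodule.span K {Twisted.basis α g}
    isInternal := by
      refine DirectSum.isInternal_submodule_of_iSupIndep_of_iSup_eq_top
        (Twisted.basis α).linearIndependent.iSupIndep_span_singleton ?_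
      rw [← Submodule.span_range_eq_iSup, (Twisted.basis α).span_eq]
    mul_mem := by
      intro a b x y hx hy
      obtain ⟨c, rfl⟩ := Submodule.mem_span_singleton.1 hx
      obtain ⟨d, rfl⟩ := Submodule.mem_span_singleton.1 hy
      change Twisted.mulHom α _ _ ∈ _
      rw [LinearMap.map_smul₂, map_smul, Twisted.mulHom_basis]
      exact Submodule.smul_mem _ _ (Submodule.smul_mem _ _ (Submodule.smul_mem _ _
        (Submodule.mem_span_singleton_self _)))
    finrank_eq_one := fun g => finrank_span_singleton ((Twisted.basis α).ne_zero g)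
    mul_ne_zero := by
      intro a b x y hx hy hx0 hy0
      obtain ⟨c, rfl⟩ := Submodule.mem_span_singleton.1 hx
      obtain ⟨d, rfl⟩ := Submodule.mem_span_singleton.1 hy
      change Twisted.mulHom α _ _ ≠ 0
      rw [LinearMap.map_smul₂, map_smul, Twisted.mulHom_basis]
      exact smul_ne_zero (smul_ne_zero_iff.1 hx0).1 (smul_ne_zero (smul_ne_zero_iff.1 hy0).1
        (smul_ne_zero (α a b).ne_zero ((Twisted.basis α).ne_zero _)))
    one_mem := Submodule.mem_span_singleton_self _ }

theorem exists_isFrame_twisted {α : G → G → Kˣ} (hα : IsNormalizedCocycle α) :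
    ∃ u, IsFrame (twisted.{w} hα) α u := by
  have h0 : ∀ g, Twisted.basis.{w} α g ≠ 0 := (Twisted.basis α).ne_zero
  have h1 : ∀ g, Twisted.basis.{w} α g ∈ Submodule.span K {Twisted.basis.{w} α g} :=
    fun _ => Submodule.mem_span_singleton_self _
  exact ⟨fun g => Twisted.basis.{w} α g, h1, h0, rfl, Twisted.mulHom_basis α⟩

end TwistedGroupAlgebra

/-! ### Commutation factors -/

section Commutator

variable {G A : Type*} [CommGroup G] [CommGroup A]

/-- The commutation factor of a cocycle on an abelian group is multiplicative. -/
theorem commutator_mul_left {α : G → G → A}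
    (h : ∀ a b c, α a b * α (a * b) c = α b c * α a (b * c)) (a b c : G) :
    α (a * b) c / α c (a * b) = α a c / α c a * (α b c / α c b) := by
  -- The cocycle identities for `(a, b, c)`, `(c, a, b)` and `(a, c, b)` combine to the claim after
  -- multiplication by the common factor `α a b * α (c * a) b`.
  have h1 := h a b c
  have h2 := h c a b
  have h3 := h a c b
  rw [mul_comm c b, mul_comm a c] at h3
  rw [div_mul_div_comm, div_eq_div_iff_mul_eq_mul]
  apply mul_left_cancel (a := α a b * α (c * a) b)
  calc α a b * α (c * a) b * (α (a * b) c * (α c a * α c b))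
      = α a b * α (a * b) c * (α c a * α (c * a) b) * α c b := by ac_rfl
    _ = α b c * (α a b * α c (a * b)) * (α c b * α a (b * c)) := by rw [h1, h2]; ac_rfl
    _ = α a b * α (c * a) b * (α a c * α b c * α c (a * b)) := by rw [← h3]; ac_rfl

theorem commutator_mul_right {α : G → G → A}
    (h : ∀ a b c, α a b * α (a * b) c = α b c * α a (b * c)) (a b c : G) :
    α a (b * c) / α (b * c) a = α a b / α b a * (α a c / α c a) := by
  rw [← inv_div, commutator_mul_left h, mul_inv, inv_div, inv_div]

end Commutator

/-! ### Abelian extensions from symmetric cocycles -/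

section SymmetricCocycle

/-- The abelian extension of `G` by `A` given by a symmetric cocycle. -/
structure Extension {G A : Type*} (_ : G → G → A) where
  base : G
  fibre : A

namespace Extension

variable {G A : Type*} [CommGroup G] [CommGroup A] {α : G → G → A}

instance : Mul (Extension α) := ⟨fun x y => ⟨x.base * y.base, x.fibre * y.fibre * α x.base y.base⟩⟩

instance : One (Extension α) := ⟨⟨1, 1⟩⟩

/-- The commutative monoid structure on the extension. -/
abbrev commMonoid (h : ∀ a b c, α a b * α (a * b) c = α b c * α a (b * c))
    (h1 : ∀ a, α 1 a = 1) (hs : ∀ a b, α a b = α b a) : CommMonoid (Extension α) where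
  mul_assoc x y z := by
    change mk _ _ = mk _ _
    congr 1
    · exact mul_assoc _ _ _
    · change x.fibre * y.fibre * α x.base y.base * z.fibre * α (x.base * y.base) z.base =
        x.fibre * (y.fibre * z.fibre * α y.base z.base) * α x.base (y.base * z.base)
      have := h x.base y.base z.base
      calc _ = x.fibre * y.fibre * z.fibre * (α x.base y.base * α (x.base * y.base) z.base) := by
            ac_rfl
        _ = _ := by rw [this]; ac_rfl
  one_mul x := by
    change mk (1 * x.base) (1 * x.fibre * α 1 x.base) = x
    simp [h1]
  mul_one x := by
    change mk (x.base * 1) (x.fibre * 1 * α x.base 1) = x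
    simp [hs _ 1, h1]
  mul_comm x y := by
    change mk _ _ = mk _ _
    congr 1
    · exact mul_comm _ _
    · rw [hs, mul_comm x.fibre]

end Extension

end SymmetricCocycle

/-! ### Powers and roots of unity in `ℝˣ` -/

section Reals

/-- This describes `ℝˣ` modulo `m`-th powers: the `m`-th root of `|r|⁻¹` scales `r` to its sign. -/
theorem exists_pow_mul_eq_unit (m : ℕ) (hm : m ≠ 0) (r : ℝˣ) :
    ∃ (t : ℝˣ) (σ : ℤˣ), t ^ m * r = Units.map (Int.castRingHom ℝ) σ ∧ (Odd m → σ = 1) := by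
  have hr : (0 : ℝ) < |(r : ℝ)|⁻¹ := inv_pos.2 (abs_pos.2 r.ne_zero)
  have hpow : ((|(r : ℝ)|⁻¹) ^ ((m : ℝ)⁻¹)) ^ m = |(r : ℝ)|⁻¹ := Real.rpow_inv_natCast_pow hr.le hm
  obtain ⟨t, ht⟩ : ∃ t : ℝˣ, (t : ℝ) = |(r : ℝ)|⁻¹ ^ ((m : ℝ)⁻¹) :=
    ⟨Units.mk0 _ (Real.rpow_pos_of_pos hr _).ne', rfl⟩
  rw [← ht] at hpow
  obtain ⟨σ, hσ⟩ : ∃ σ : ℤˣ, t ^ m * r = Units.map (Int.castRingHom ℝ) σ := by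
    rcases lt_or_gt_of_ne r.ne_zero with h | h
    · refine ⟨-1, Units.ext ?_⟩
      rw [Units.val_mul, Units.val_pow_eq_pow_val, hpow, abs_of_neg h]
      simp [inv_neg]
    · refine ⟨1, Units.ext ?_⟩
      rw [Units.val_mul, Units.val_pow_eq_pow_val, hpow, abs_of_pos h]
      simp
  rcases Nat.even_or_odd m with he | ho
  · exact ⟨t, σ, hσ, fun ho => absurd he (Nat.not_even_iff_odd.2 ho)⟩
  -- For odd `m` a sign is its own `m`-th power, so it can be absorbed into `t`.
  · refine ⟨Units.map (Int.castRingHom ℝ) σ * t, 1, ?_, fun _ => rfl⟩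
    rw [mul_pow, mul_assoc, hσ, ← map_pow, ← map_mul]
    rcases Int.units_eq_one_or σ with rfl | rfl
    · simp
    · simp [ho.neg_one_pow]

theorem exists_sign_of_pow_eq_one {m l : ℕ} (hm : m ≠ 0) (hl : l ≠ 0) {r : ℝˣ} (h : r ^ m = 1)
    (h' : r ^ l = 1) :
    ∃ σ : ℤˣ, r = Units.map (Int.castRingHom ℝ) σ ∧ (¬(Even m ∧ Even l) → σ = 1) := by
  have h1 : (r : ℝ) ^ m = 1 := by rw [← Units.val_pow_eq_pow_val, h, Units.val_one]
  have h2 : (r : ℝ) ^ l = 1 := by rw [← Units.val_pow_eq_pow_val, h', Units.val_one]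
  rw [pow_eq_one_iff_of_ne_zero hm] at h1
  rw [pow_eq_one_iff_of_ne_zero hl] at h2
  rcases h1 with h1 | ⟨h1, hme⟩
  · exact ⟨1, Units.ext (by simp [h1]), fun _ => rfl⟩
  · rcases h2 with h2 | ⟨-, hle⟩
    · norm_num [h1] at h2
    · exact ⟨-1, Units.ext (by simp [h1]), fun h => absurd ⟨hme, hle⟩ h⟩

theorem units_map_intCast_injective : Function.Injective (Units.map (Int.castRingHom ℝ : ℤ →* ℝ)) :=
  Units.map_injective (Int.cast_injective)

end Reals

/-! ### Coordinates and carries in the product of cyclic groups -/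

section Product

variable {k : ℕ} {n : Fin k → ℕ}

/-- The representative in `ℕ` of the `i`-th coordinate. -/
def rep (x : ∀ i, Multiplicative (ZMod (n i))) (i : Fin k) : ℕ := (x i).toAdd.val

/-- The generator of the `i`-th factor. -/
def gen (n : Fin k → ℕ) (i : Fin k) : ∀ i, Multiplicative (ZMod (n i)) :=
  Pi.mulSingle i (.ofAdd 1)

/-- The carry in the `i`-th coordinate when adding representatives. -/
def carry (x y : ∀ i, Multiplicative (ZMod (n i))) (i : Fin k) : ℕ := (rep x i + rep y i) / n i

theorem gen_pow (i : Fin k) : gen n i ^ n i = 1 := by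
  rw [gen, ← Pi.mulSingle_pow, ← ofAdd_nsmul]
  simp

theorem carry_comm (x y : ∀ i, Multiplicative (ZMod (n i))) (i : Fin k) :
    carry x y i = carry y x i := by
  rw [carry, carry, add_comm]

theorem rep_one (i : Fin k) : rep (1 : ∀ i, Multiplicative (ZMod (n i))) i = 0 := by
  simp [rep]

theorem rep_mulSingle (i j : Fin k) (m : ℕ) :
    rep (Pi.mulSingle i (.ofAdd (m : ZMod (n i))) : ∀ i, Multiplicative (ZMod (n i))) j =
      if j = i then m % n i else 0 := by
  rcases eq_or_ne j i with rfl | h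
  · simp [rep, ZMod.val_natCast]
  · simp [rep, h]

/-- The remainder `1 % n i` accounts for a trivial factor, `n i = 1`. -/
theorem rep_gen (i j : Fin k) : rep (gen n i) j = if j = i then 1 % n i else 0 := by
  simpa [gen] using rep_mulSingle (n := n) i j 1

variable [∀ i, NeZero (n i)]

theorem rep_lt (x : ∀ i, Multiplicative (ZMod (n i))) (i : Fin k) : rep x i < n i :=
  ZMod.val_lt _

theorem rep_mul (x y : ∀ i, Multiplicative (ZMod (n i))) (i : Fin k) :
    rep (x * y) i = (rep x i + rep y i) % n i :=
  ZMod.val_add _ _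

theorem rep_add_rep (x y : ∀ i, Multiplicative (ZMod (n i))) (i : Fin k) :
    rep x i + rep y i = n i * carry x y i + rep (x * y) i := by
  rw [rep_mul, carry, Nat.div_add_mod]

theorem carry_one_left (x : ∀ i, Multiplicative (ZMod (n i))) (i : Fin k) : carry 1 x i = 0 := by
  rw [carry, rep_one, zero_add, Nat.div_eq_of_lt (rep_lt x i)]

/-- Multiplied by `n i`, both sides are the sum of the three representatives minus that of the
product. -/
theorem carry_assoc (x y z : ∀ i, Multiplicative (ZMod (n i))) (i : Fin k) :
    carry x y i + carry (x * y) z i = carry y z i + carry x (y * z) i := by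
  have h1 := rep_add_rep x y i
  have h2 := rep_add_rep (x * y) z i
  have h3 := rep_add_rep y z i
  have h4 := rep_add_rep x (y * z) i
  rw [mul_assoc] at h2
  apply Nat.eq_of_mul_eq_mul_left (Nat.pos_of_ne_zero (NeZero.ne (n i)))
  rw [mul_add, mul_add]
  omega

theorem prod_gen_pow (x : ∀ i, Multiplicative (ZMod (n i))) : ∏ i, gen n i ^ rep x i = x := by
  conv_rhs => rw [← Finset.univ_prod_mulSingle x]
  refine Finset.prod_congr rfl fun i _ => ?_
  rw [gen, ← Pi.mulSingle_pow, ← ofAdd_nsmul, rep]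
  congr 1
  simp

/-! ### Bicharacters and standard cocycles -/

section Bicharacter

variable {A : Type*} [CommGroup A]

theorem hom_ext_gen {φ ψ : (∀ i, Multiplicative (ZMod (n i))) →* A}
    (h : ∀ i, φ (gen n i) = ψ (gen n i)) : φ = ψ := by
  refine MonoidHom.ext fun x => ?_
  rw [← prod_gen_pow x, map_prod, map_prod]
  simp [h]

theorem bimultiplicative_ext {B C : (∀ i, Multiplicative (ZMod (n i))) →
      (∀ i, Multiplicative (ZMod (n i))) → A}
    (hB : ∀ x y z, B (x * y) z = B x z * B y z) (hB' : ∀ x y z, B x (y * z) = B x y * B x z)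
    (hC : ∀ x y z, C (x * y) z = C x z * C y z) (hC' : ∀ x y z, C x (y * z) = C x y * C x z)
    (h : ∀ i j, B (gen n i) (gen n j) = C (gen n i) (gen n j)) (x y) : B x y = C x y := by
  have h1 : ∀ i y, B (gen n i) y = C (gen n i) y := fun i y =>
    DFunLike.congr_fun (f := MonoidHom.mk' (B (gen n i)) (hB' _))
      (g := MonoidHom.mk' (C (gen n i)) (hC' _)) (hom_ext_gen (h i)) y
  exact DFunLike.congr_fun (f := MonoidHom.mk' (B · y) (hB · · y))
      (g := MonoidHom.mk' (C · y) (hC · · y)) (hom_ext_gen (h1 · y)) x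

omit [∀ i, NeZero (n i)] in
theorem bichar_pow {B : (∀ i, Multiplicative (ZMod (n i))) →
    (∀ i, Multiplicative (ZMod (n i))) → A} (hB : ∀ x y z, B (x * y) z = B x z * B y z) (i y) :
    B (gen n i) y ^ n i = 1 := by
  have := map_pow (MonoidHom.mk' (B · y) (hB · · y)) (gen n i) (n i)
  rw [gen_pow, map_one] at this
  exact this.symm

/-- The bimultiplicative map with the entries of `M` above the diagonal as its values on pairs of
generators. -/
def bichar (M : Fin k → Fin k → A) (x y : ∀ i, Multiplicative (ZMod (n i))) : A :=
  ∏ i, ∏ j, if i < j then M i j ^ (rep x i * rep y j) else 1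

omit [∀ i, NeZero (n i)] in
theorem bichar_congr {M N : Fin k → Fin k → A} (h : ∀ i j, i < j → M i j = N i j)
    (x y : ∀ i, Multiplicative (ZMod (n i))) : bichar M x y = bichar N x y :=
  Finset.prod_congr rfl fun i _ => Finset.prod_congr rfl fun j _ => by
    split_ifs with hij
    · rw [h i j hij]
    · rfl

theorem bichar_mul_left {M : Fin k → Fin k → A} (hM : ∀ i j, M i j ^ n i = 1)
    (x y z : ∀ i, Multiplicative (ZMod (n i))) :
    bichar M (x * y) z = bichar M x z * bichar M y z := by
  simp only [bichar, ← Finset.prod_mul_distrib]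
  refine Finset.prod_congr rfl fun i _ => Finset.prod_congr rfl fun j _ => ?_
  split_ifs
  · rw [rep_mul, pow_mul, ← pow_eq_pow_mod _ (hM i j), ← pow_mul, add_mul, pow_add]
  · rw [mul_one]

theorem bichar_mul_right {M : Fin k → Fin k → A} (hM : ∀ i j, M i j ^ n j = 1)
    (x y z : ∀ i, Multiplicative (ZMod (n i))) :
    bichar M x (y * z) = bichar M x y * bichar M x z := by
  simp only [bichar, ← Finset.prod_mul_distrib]
  refine Finset.prod_congr rfl fun i _ => Finset.prod_congr rfl fun j _ => ?_
  split_ifs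
  · rw [rep_mul, mul_comm, pow_mul, ← pow_eq_pow_mod _ (hM i j), ← pow_mul, add_mul, pow_add,
      mul_comm (rep y j), mul_comm (rep z j)]
  · rw [mul_one]

omit [∀ i, NeZero (n i)] in
theorem bichar_gen {M : Fin k → Fin k → A} (hM : ∀ i j, M i j ^ n i = 1)
    (hM' : ∀ i j, M i j ^ n j = 1) (i j : Fin k) :
    bichar M (gen n i) (gen n j) = if i < j then M i j else 1 := by
  rw [bichar, Finset.prod_eq_single i, Finset.prod_eq_single j]
  · rw [rep_gen, rep_gen, if_pos rfl, if_pos rfl, pow_mul, ← pow_eq_pow_mod _ (hM i j), pow_one,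
      ← pow_eq_pow_mod _ (hM' i j), pow_one]
  · intro l _ hl
    simp [rep_gen, hl]
  · simp
  · intro l _ hl
    simp [rep_gen, hl]
  · simp

omit [∀ i, NeZero (n i)] in
theorem bichar_one_left (M : Fin k → Fin k → A) (x : ∀ i, Multiplicative (ZMod (n i))) :
    bichar M 1 x = 1 := by
  simp [bichar, rep_one]

omit [∀ i, NeZero (n i)] in
theorem bichar_one_right (M : Fin k → Fin k → A) (x : ∀ i, Multiplicative (ZMod (n i))) :
    bichar M x 1 = 1 := by
  simp [bichar, rep_one]

/-- A symmetric cocycle is determined by the values of the `n i`-th powers of lifts of generators,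
which may be chosen to be any elements of their classes modulo `n i`-th powers. -/
theorem exists_carry_form {α : (∀ i, Multiplicative (ZMod (n i))) →
      (∀ i, Multiplicative (ZMod (n i))) → A}
    (h : ∀ a b c, α a b * α (a * b) c = α b c * α a (b * c))
    (h1 : ∀ a, α 1 a = 1) (hs : ∀ a b, α a b = α b a) :
    ∃ r : Fin k → A, ∀ t : Fin k → A, ∃ f : (∀ i, Multiplicative (ZMod (n i))) → A,
      f 1 = 1 ∧
      ∀ a b, f a * f b * α a b = (∏ i, (t i ^ n i * r i) ^ carry a b i) * f (a * b) := by
  -- Symmetry of `α` makes the extension commutative, so products of powers of lifts can be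
  -- regrouped.
  let _ := Extension.commMonoid h h1 hs
  let π : Extension α →* ∀ i, Multiplicative (ZMod (n i)) :=
    { toFun := Extension.base, map_one' := rfl, map_mul' := fun _ _ => rfl }
  let ι : A →* Extension α :=
    { toFun := fun a => ⟨1, a⟩
      map_one' := rfl
      map_mul' := fun a b => by
        change Extension.mk _ _ = Extension.mk (1 * 1) (a * b * α 1 1)
        rw [h1, mul_one, mul_one] }
  have hι : ∀ a (z : Extension α), (ι a * z).fibre = a * z.fibre := fun a z => by
    change a * z.fibre * α 1 z.base = _
    rw [h1, mul_one]
  let e : Fin k → Extension α := fun i => ⟨gen n i, 1⟩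
  -- The `n i`-th power of a lifted generator lies over `1`, hence in `A`; its fibre is the
  -- parameter `r i`.
  have he : ∀ i, e i ^ n i = ι (e i ^ n i).fibre := fun i => by
    have hb : (e i ^ n i).base = 1 := by
      change π (e i ^ n i) = 1
      rw [map_pow]
      exact gen_pow i
    exact congrArg (Extension.mk · _) hb
  refine ⟨fun i => (e i ^ n i).fibre, fun t => ?_⟩
  -- A section made of monomials in the rescaled lifts. In `U a * U b` the exponents overflow
  -- exactly by the carries, which yields the asserted cocycle.
  let U : (∀ i, Multiplicative (ZMod (n i))) → Extension α := fun x =>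
    ∏ i, (ι (t i) * e i) ^ rep x i
  have hU : ∀ x, (U x).base = x := fun x => by
    change π (U x) = x
    conv_rhs => rw [← prod_gen_pow x]
    rw [map_prod]
    refine Finset.prod_congr rfl fun i _ => ?_
    rw [map_pow, map_mul]
    congr 1
    exact one_mul _
  refine ⟨fun x => (U x).fibre, ?_, fun a b => ?_⟩
  · have : U 1 = 1 := by simp [U, rep_one]
    exact congrArg Extension.fibre this
  · have : U a * U b = ι (∏ i, (t i ^ n i * (e i ^ n i).fibre) ^ carry a b i) * U (a * b) := by
      simp only [U, map_prod, ← Finset.prod_mul_distrib]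
      refine Finset.prod_congr rfl fun i _ => ?_
      rw [← pow_add, rep_add_rep, pow_add, pow_mul, map_pow, map_mul, ← he, map_pow, mul_pow]
    have := congrArg Extension.fibre this
    rw [hι] at this
    rw [← this]
    change _ = (U a).fibre * (U b).fibre * α (U a).base (U b).base
    rw [hU, hU]

/-- The standard cocycle with parameters `M`. -/
def stdCocycle (n : Fin k → ℕ) (M : Fin k → Fin k → A)
    (x y : ∀ i, Multiplicative (ZMod (n i))) : A :=
  bichar M x y * ∏ i, M i i ^ carry x y i

theorem stdCocycle_assoc {M : Fin k → Fin k → A} (hM : ∀ i j, M i j ^ n i = 1)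
    (hM' : ∀ i j, M i j ^ n j = 1) (a b c : ∀ i, Multiplicative (ZMod (n i))) :
    stdCocycle n M a b * stdCocycle n M (a * b) c =
      stdCocycle n M b c * stdCocycle n M a (b * c) := by
  have : (∏ i, M i i ^ carry a b i) * ∏ i, M i i ^ carry (a * b) c i =
      (∏ i, M i i ^ carry b c i) * ∏ i, M i i ^ carry a (b * c) i := by
    simp only [← Finset.prod_mul_distrib, ← pow_add, carry_assoc]
  rw [stdCocycle, stdCocycle, stdCocycle, stdCocycle, mul_mul_mul_comm, this,
    bichar_mul_left hM, bichar_mul_right hM', mul_mul_mul_comm (bichar M b c)]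
  congr 1
  ac_rfl

theorem stdCocycle_one_left (M : Fin k → Fin k → A) (x : ∀ i, Multiplicative (ZMod (n i))) :
    stdCocycle n M 1 x = 1 := by
  simp [stdCocycle, bichar_one_left, carry_one_left]

theorem stdCocycle_one_right (M : Fin k → Fin k → A) (x : ∀ i, Multiplicative (ZMod (n i))) :
    stdCocycle n M x 1 = 1 := by
  simp [stdCocycle, bichar_one_right, carry_comm x 1, carry_one_left]

-- The carry factor is symmetric and cancels, so commutators recover the off-diagonal parameters.
omit [∀ i, NeZero (n i)] in
theorem stdCocycle_gen_div {M : Fin k → Fin k → A} (hM : ∀ i j, M i j ^ n i = 1)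
    (hM' : ∀ i j, M i j ^ n j = 1) {i j : Fin k} (hij : i < j) :
    stdCocycle n M (gen n i) (gen n j) / stdCocycle n M (gen n j) (gen n i) = M i j := by
  rw [stdCocycle, stdCocycle, bichar_gen hM hM', bichar_gen hM hM', if_pos hij, if_neg hij.not_gt]
  simp [carry_comm (gen n j)]

/-- The element of order two in the `i`-th factor, when `n i` is even. -/
def half (n : Fin k → ℕ) (i : Fin k) : ∀ i, Multiplicative (ZMod (n i)) :=
  Pi.mulSingle i (.ofAdd ((n i / 2 : ℕ) : ZMod (n i)))

omit [∀ i, NeZero (n i)] in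
theorem half_mul_half {i : Fin k} (hi : Even (n i)) : half n i * half n i = 1 := by
  rw [half, ← Pi.mulSingle_mul, ← ofAdd_add, ← Nat.cast_add, ← two_mul,
    Nat.two_mul_div_two_of_even hi]
  simp

/-- Only one coordinate is nonzero, so the bicharacter is trivial, and `n i / 2 + n i / 2` carries
exactly once. -/
theorem stdCocycle_half (M : Fin k → Fin k → A) {i : Fin k} (hi : Even (n i)) :
    stdCocycle n M (half n i) (half n i) = M i i := by
  have hpos : 0 < n i := Nat.pos_of_ne_zero (NeZero.ne (n i))
  have hb : bichar M (half n i) (half n i) = 1 := by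
    refine Finset.prod_eq_one fun a _ => Finset.prod_eq_one fun b _ => ?_
    split_ifs with hab
    · rw [half, rep_mulSingle, rep_mulSingle]
      rcases eq_or_ne a i with rfl | ha
      · simp [hab.ne']
      · simp [ha]
    · rfl
  rw [stdCocycle, hb, one_mul, Finset.prod_eq_single i]
  · rw [carry, half, rep_mulSingle, if_pos rfl, Nat.mod_eq_of_lt (Nat.div_lt_self hpos one_lt_two),
      ← two_mul, Nat.two_mul_div_two_of_even hi, Nat.div_self hpos, pow_one]
  · intro j _ hj
    simp [carry, half, rep_mulSingle, hj]
  · simp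

end Bicharacter

end Product

/-! ### Classification by sign matrices -/

section Classification

variable {k : ℕ} {n : Fin k → ℕ}

/-- The matrix of signs attached to a function on unordered pairs of even indices. -/
def signMatrix (P : Sym2 {i : Fin k // Even (n i)} → ℤˣ) (i j : Fin k) : ℝˣ :=
  if h : Even (n i) ∧ Even (n j) then
    Units.map (Int.castRingHom ℝ : ℤ →* ℝ) (P s(⟨i, h.1⟩, ⟨j, h.2⟩))
  else 1

theorem signMatrix_pow_left (P : Sym2 {i : Fin k // Even (n i)} → ℤˣ) (i j : Fin k) :
    signMatrix P i j ^ n i = 1 := by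
  rw [signMatrix]
  split_ifs with h
  · rw [← map_pow, ← Nat.two_mul_div_two_of_even h.1, pow_mul, Int.units_sq, one_pow, map_one]
  · exact one_pow _

theorem signMatrix_comm (P : Sym2 {i : Fin k // Even (n i)} → ℤˣ) (i j : Fin k) :
    signMatrix P i j = signMatrix P j i := by
  simp only [signMatrix, Sym2.eq_swap, and_comm]

theorem signMatrix_pow_right (P : Sym2 {i : Fin k // Even (n i)} → ℤˣ) (i j : Fin k) :
    signMatrix P i j ^ n j = 1 := by
  rw [signMatrix_comm, signMatrix_pow_left]

theorem exists_signMatrix_eq {σ : Fin k → Fin k → ℤˣ} (hs : ∀ i j, σ i j = σ j i)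
    (h1 : ∀ i j, ¬(Even (n i) ∧ Even (n j)) → σ i j = 1) :
    ∃ P : Sym2 {i : Fin k // Even (n i)} → ℤˣ, ∀ i j,
      signMatrix P i j = Units.map (Int.castRingHom ℝ : ℤ →* ℝ) (σ i j) := by
  refine ⟨Sym2.lift ⟨fun i j => σ i j, fun i j => hs i j⟩, fun i j => ?_⟩
  rw [signMatrix]
  split_ifs with h
  · rfl
  · rw [h1 i j h, map_one]

variable [∀ i, NeZero (n i)]

theorem isNormalizedCocycle_signMatrix (P : Sym2 {i : Fin k // Even (n i)} → ℤˣ) :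
    IsNormalizedCocycle (stdCocycle n (signMatrix P)) where
  assoc := stdCocycle_assoc (signMatrix_pow_left P) (signMatrix_pow_right P)
  one_left := stdCocycle_one_left _
  one_right := stdCocycle_one_right _

theorem IsNormalizedCocycle.exists_signMatrix {α : (∀ i, Multiplicative (ZMod (n i))) →
      (∀ i, Multiplicative (ZMod (n i))) → ℝˣ} (hα : IsNormalizedCocycle α) :
    ∃ (P : Sym2 {i : Fin k // Even (n i)} → ℤˣ) (f : (∀ i, Multiplicative (ZMod (n i))) → ℝˣ),
      f 1 = 1 ∧ ∀ a b, f a * f b * α a b = stdCocycle n (signMatrix P) a b * f (a * b) := by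
  let B := fun x y => α x y / α y x
  have hBl : ∀ x y z, B (x * y) z = B x z * B y z := commutator_mul_left hα.assoc
  have hBr : ∀ x y z, B x (y * z) = B x y * B x z := commutator_mul_right hα.assoc
  let β : Fin k → Fin k → ℝˣ := fun i j => B (gen n i) (gen n j)
  have hβs : ∀ i j, β j i = (β i j)⁻¹ := fun i j => (inv_div _ _).symm
  have hβ : ∀ i j, β i j ^ n i = 1 := fun i j => bichar_pow hBl i _
  have hβ' : ∀ i j, β i j ^ n j = 1 := fun i j => by
    rw [hβs j i, inv_pow, hβ, inv_one]
  -- Both sides are bimultiplicative, so generators suffice. Hence `α / bichar β` is symmetric.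
  have hBβ : ∀ x y, B x y = bichar β x y / bichar β y x := by
    refine bimultiplicative_ext hBl hBr (fun x y z => ?_) (fun x y z => ?_) fun i j => ?_
    · rw [bichar_mul_left hβ, bichar_mul_right hβ', mul_div_mul_comm]
    · rw [bichar_mul_left hβ, bichar_mul_right hβ', mul_div_mul_comm]
    · rw [bichar_gen hβ hβ', bichar_gen hβ hβ']
      rcases lt_trichotomy i j with h | rfl | h
      · rw [if_pos h, if_neg h.not_gt, div_one]
      · rw [if_neg (lt_irrefl i), div_one]
        exact div_self' _
      · rw [if_pos h, if_neg h.not_gt, one_div]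
        exact hβs j i
  obtain ⟨r, hr⟩ := exists_carry_form (n := n) (α := fun x y => α x y / bichar β x y)
    (fun a b c => by
      rw [div_mul_div_comm, div_mul_div_comm, hα.assoc, bichar_mul_left hβ, bichar_mul_right hβ']
      congr 1
      ac_rfl)
    (fun a => by rw [hα.one_left, bichar_one_left, div_one])
    (fun a b => by
      rw [div_eq_div_iff_div_eq_div]
      exact hBβ a b)
  choose t τ hτ hτ1 using fun i => exists_pow_mul_eq_unit (n i) (NeZero.ne _) (r i)
  obtain ⟨f, hf1, hf⟩ := hr t
  choose σ hσ hσ1 using fun i j =>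
    exists_sign_of_pow_eq_one (NeZero.ne (n i)) (NeZero.ne (n j)) (hβ i j) (hβ' i j)
  -- Diagonal signs come from the powers of lifts, off-diagonal ones from the commutators.
  obtain ⟨P, hP⟩ := exists_signMatrix_eq (n := n) (σ := fun i j => if i = j then τ i else σ i j)
    (fun i j => by
      rcases eq_or_ne i j with rfl | h
      · rfl
      · rw [if_neg h, if_neg h.symm]
        apply units_map_intCast_injective
        rw [← hσ, ← hσ, hβs j i, hσ, ← map_inv, Int.units_inv_eq_self])
    (fun i j h => by
      rcases eq_or_ne i j with rfl | h'
      · rw [if_pos rfl, hτ1 i (Nat.not_even_iff_odd.1 fun he => h ⟨he, he⟩)]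
      · rw [if_neg h', hσ1 i j h])
  refine ⟨P, f, hf1, fun a b => ?_⟩
  have hb : bichar (signMatrix P) a b = bichar β a b :=
    bichar_congr (fun i j hij => by rw [hP, if_neg hij.ne, hσ]) a b
  have hc : ∀ i, signMatrix P i i = t i ^ n i * r i := fun i => by rw [hP, if_pos rfl, hτ]
  have := hf a b
  rw [stdCocycle, hb]
  simp only [hc]
  rw [mul_assoc (bichar β a b), ← this, ← mul_div_assoc, mul_div_cancel]

/-- Coboundaries are symmetric, so commutators fix the off-diagonal signs. At an element of order
two a coboundary is a square, hence positive, which fixes the diagonal signs. -/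
theorem eq_of_stdCocycle_cohomologous {P Q : Sym2 {i : Fin k // Even (n i)} → ℤˣ}
    {t : (∀ i, Multiplicative (ZMod (n i))) → ℝˣ}
    (ht : ∀ a b, stdCocycle n (signMatrix P) a b * t (a * b) =
      t a * t b * stdCocycle n (signMatrix Q) a b) : P = Q := by
  have t1 : t 1 = 1 := by
    have := ht 1 1
    rw [stdCocycle_one_left, stdCocycle_one_left, one_mul, mul_one, mul_one] at this
    exact left_eq_mul.1 this
  have key : ∀ i j : {i : Fin k // Even (n i)}, (i : Fin k) < j →
      P s(i, j) = Q s(i, j) := fun i j hij => by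
    have h1 := ht (gen n i) (gen n j)
    have h2 := ht (gen n j) (gen n i)
    have hPQ : signMatrix P i j = signMatrix Q i j := by
      rw [← stdCocycle_gen_div (signMatrix_pow_left P) (signMatrix_pow_right P) hij,
        ← stdCocycle_gen_div (signMatrix_pow_left Q) (signMatrix_pow_right Q) hij,
        ← mul_div_mul_right_eq_div _ _ (t (gen n i * gen n j)), h1, mul_comm (gen n i), h2,
        mul_comm (t (gen n j)), mul_div_mul_left_eq_div]
    rw [signMatrix, signMatrix, dif_pos ⟨i.2, j.2⟩, dif_pos ⟨i.2, j.2⟩] at hPQ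
    exact units_map_intCast_injective hPQ
  funext z
  induction z with | _ i j
  rcases lt_trichotomy (i : Fin k) j with h | h | h
  · exact key i j h
  · obtain rfl := Subtype.ext h
    have := ht (half n i) (half n i)
    rw [half_mul_half i.2, t1, stdCocycle_half _ i.2, stdCocycle_half _ i.2, mul_one, signMatrix,
      signMatrix, dif_pos ⟨i.2, i.2⟩, dif_pos ⟨i.2, i.2⟩] at this
    have hpos := mul_self_pos.2 (t (half n i)).ne_zero
    have hv := congrArg Units.val this
    rcases Int.units_eq_one_or (P s(i, i)) with hp | hp <;>
    rcases Int.units_eq_one_or (Q s(i, i)) with hq | hq <;>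
    simp [hp, hq] at hv ⊢ <;> linarith
  · rw [Sym2.eq_swap]
    exact key j i h

end Classification

end GradedTwistedAlgebra

/-! ### The count -/

open GradedTwistedAlgebra in
theorem mainTheorem3 (k s : ℕ) (n : Fin k → ℕ) (hn : ∀ i, 0 < n i)
    (hs : Fintype.card {i : Fin k // Even (n i)} = s) :
    Nat.card (GradedTwistedAlgebra.AssocIsoClasses.{0, 0, w} ℝ
      (∀ i : Fin k, Multiplicative (ZMod (n i)))) = 2 ^ (s * (s + 1) / 2) := by
  have : ∀ i, NeZero (n i) := fun i => ⟨(hn i).ne'⟩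
  choose u hu using fun P : Sym2 {i : Fin k // Even (n i)} → ℤˣ =>
    exists_isFrame_twisted.{w} (isNormalizedCocycle_signMatrix P)
  let F : (Sym2 {i : Fin k // Even (n i)} → ℤˣ) → AssocIsoClasses.{0, 0, w} ℝ
      (∀ i : Fin k, Multiplicative (ZMod (n i))) := fun P =>
    Quotient.mk _ ⟨twisted (isNormalizedCocycle_signMatrix P),
      (hu P).isAssociative (isNormalizedCocycle_signMatrix P)⟩
  have hF : Function.Bijective F := by
    refine ⟨fun P Q hPQ => ?_, fun C => ?_⟩
    · obtain ⟨t, ht⟩ := (hu P).exists_cohomologous (hu Q) (Quotient.exact hPQ)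
      exact eq_of_stdCocycle_cohomologous ht
    · induction C using Quotient.inductionOn with | _ W
      obtain ⟨α, v, hv⟩ := W.1.exists_isFrame
      obtain ⟨P, f, hf1, hf⟩ := (hv.isNormalizedCocycle W.2).exists_signMatrix
      exact ⟨P, Quotient.sound ((hu P).gradedIsomorphic (hv.rescale hf1 hf))⟩
  -- The exponent is the number `(s + 1).choose 2` of unordered pairs with repetition.
  rw [← Nat.card_eq_of_bijective F hF, Nat.card_eq_fintype_card, Fintype.card_fun, Sym2.card, hs,
    Fintype.card_units_int, Nat.choose_two_right, Nat.add_sub_cancel, mul_comm]
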